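/- Let $m\ge k$ be integers, $\tau\in(0,1)$, $\beta_0,\beta^p\in\mathbb R^k$ and $\Gamma_0\in\mathbb R^{m\times k}$, and consider the linear instrumental variables model $$y_i=x_i'\beta_0+\varepsilon_i,\qquad x_i=\Gamma_0'z_i+u_i,\qquad i=1,2,\dots,$$ with $y_i,\varepsilon_i\in\mathbb R$, $x_i,u_i\in\mathbb R^k$, $z_i\in\mathbb R^m$. Assume: 1. the $z_i$ are iid with finite fourth moments, and $R_z=E[z_iz_i']$ has full rank; 2. conditional on $Z=(z_1,z_2,\dots)$, the vectors $(\varepsilon_i,u_i')'$ are iid with mean zero and a full rank covariance matrix that does not depend on $Z$; 3. for some finite constants $B_1,B_2,B_3,B_4>0$: $R_z$ is positive definite with all its eigenvalues in $[1/B_1,B_1]$, $|\beta_{0,j}|\le B_2$ for all $j$, $\Gamma_0$ has full rank $k$ with all its entries bounded by $B_3$ in absolute value, and the tuning parameter $\alpha$ ranges over $A=[0,\infty)$ or over $A=[0,B_4]$. Assume also that the prior is not exactly right: $\beta^p\ne\beta_0$. For a sample of size $n$, let $Y_{\tau n},X_{\tau n},Z_{\tau n}$ be the first $[\tau n]$ observations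 (training sample), with $[\cdot]$ the greatest integer function, and $Y_{n(1-\tau)},X_{n(1-\tau)},Z_{n(1-\tau)}$ the remaining $n-[\tau n]$ observations (test sample), and write $P_W=W(W'W)^{-1}W'$. For $\alpha\ge0$ let $$\hat\beta_{\tau n}(\alpha)\in\operatorname*{arg\,min}_{\beta\in\mathbb R^k}\ \frac1{2[\tau n]}(Y_{\tau n}-X_{\tau n}\beta)'P_{Z_{\tau n}}(Y_{\tau n}-X_{\tau n}\beta)+\frac\alpha2(\beta-\beta^p)'(\beta-\beta^p),$$ and let $$Q_n(\alpha)=\frac1{2(n-[\tau n])}\big(Y_{n(1-\tau)}-X_{n(1-\tau)}\hat\beta_{\tau n}(\alpha)\big)'P_{Z_{n(1-\tau)}}\big(Y_{n(1-\tau)}-X_{n(1-\tau)}\hat\beta_{\tau n}(\alpha)\big).$$ Let $\hat\alpha=\hat\alpha_n\in\operatorname*{arg\,min}_{\alpha\in A}Q_n(\alpha)$ be a minimizer whenever one exists, and arbitrary otherwise. Then, as $n\to\infty$, 1. $\hat\alpha\to0$ in probability, and 2. $\sqrt n\,\hat\alpha=O_p(1)$. -/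

import Mathlib

open MeasureTheory ProbabilityTheory Filter Topology
open scoped Matrix

namespace RidgePath

noncomputable section

variable {Ω : Type*} [MeasurableSpace Ω] {k m N : ℕ}

/-- The first-stage equation `x_i' = z_i' Γ₀ + u_i'`. -/
def regressor (Γ₀ : Matrix (Fin m) (Fin k) ℝ) (z : ℕ → Ω → Fin m → ℝ)
    (u : ℕ → Ω → Fin k → ℝ) (i : ℕ) (ω : Ω) : Fin k → ℝ :=
  z i ω ᵥ* Γ₀ + u i ω

/-- The structural equation `y_i = x_i' β₀ + ε_i`. -/
def response (β₀ : Fin k → ℝ) (Γ₀ : Matrix (Fin m) (Fin k) ℝ) (z : ℕ → Ω → Fin m → ℝ)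
    (ε : ℕ → Ω → ℝ) (u : ℕ → Ω → Fin k → ℝ) (i : ℕ) (ω : Ω) : ℝ :=
  regressor Γ₀ z u i ω ⬝ᵥ β₀ + ε i ω

/-- The stacked error vector `(ε_i, u_i')'`. -/
def errorVec (ε : ℕ → Ω → ℝ) (u : ℕ → Ω → Fin k → ℝ) (i : ℕ) (ω : Ω) : Fin (k + 1) → ℝ :=
  Matrix.vecCons (ε i ω) (u i ω)

/-- The matrix `E[w w']`. -/
def secondMoment {d : ℕ} (P : Measure Ω) (w : Ω → Fin d → ℝ) : Matrix (Fin d) (Fin d) ℝ :=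
  Matrix.of fun a b => ∫ ω, w ω a * w ω b ∂P

/-- The instruments are iid with finite fourth moments and `E[z_i z_i']` of full rank. -/
structure InstrumentAssumption (P : Measure Ω) (z : ℕ → Ω → Fin m → ℝ) : Prop where
  measurable : ∀ i, Measurable (z i)
  indep : iIndepFun z P
  identDistrib : ∀ i, IdentDistrib (z i) (z 0) P P
  fourthMoment : ∀ i a, MemLp (fun ω => z i ω a) 4 P
  fullRank : (secondMoment P (z 0)).rank = m

/-- Under the law `ν` of a sequence of random vectors, the terms of the sequence are iid,
square integrable, with mean zero and covariance matrix `V`. -/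
structure IsIIDCentered {d : ℕ} (ν : Measure (ℕ → Fin d → ℝ)) (V : Matrix (Fin d) (Fin d) ℝ) :
    Prop where
  indep : iIndepFun (fun (i : ℕ) (e : ℕ → Fin d → ℝ) => e i) ν
  identDistrib : ∀ i : ℕ,
    IdentDistrib (fun e : ℕ → Fin d → ℝ => e i) (fun e : ℕ → Fin d → ℝ => e 0) ν ν
  memLp : ∀ (i : ℕ) (a : Fin d), MemLp (fun e : ℕ → Fin d → ℝ => e i a) 2 ν
  mean : ∀ (i : ℕ) (a : Fin d), ∫ e, e i a ∂ν = 0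
  cov : ∀ i : ℕ, secondMoment ν (fun e : ℕ → Fin d → ℝ => e i) = V

/-- Conditional on the instruments, the error vectors `(ε_i, u_i')'` are iid with mean zero and
full rank covariance matrix `V`. The conditional law may depend on the instruments otherwise. -/
structure ErrorAssumption (P : Measure Ω) [IsFiniteMeasure P] (z : ℕ → Ω → Fin m → ℝ)
    (ε : ℕ → Ω → ℝ) (u : ℕ → Ω → Fin k → ℝ) (V : Matrix (Fin (k + 1)) (Fin (k + 1)) ℝ) :
    Prop where
  measurable_ε : ∀ i, Measurable (ε i)
  measurable_u : ∀ i, Measurable (u i)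
  posDef : V.PosDef
  condIID : ∀ᵐ ζ ∂(P.map fun ω i => z i ω),
    IsIIDCentered (condDistrib (fun ω i => errorVec ε u i ω) (fun ω i => z i ω) P ζ) V

/-- The bounds on the parameters `R_z`, `β₀`, `Γ₀` and the rank condition on `Γ₀`. -/
structure ParameterAssumption (R : Matrix (Fin m) (Fin m) ℝ) (β₀ : Fin k → ℝ)
    (Γ₀ : Matrix (Fin m) (Fin k) ℝ) (B₁ B₂ B₃ : ℝ) : Prop where
  posDef : R.PosDef
  eigenvalues : ∀ l ∈ spectrum ℝ R, 1 / B₁ ≤ l ∧ l ≤ B₁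
  coeff : ∀ j, |β₀ j| ≤ B₂
  fullRank : Γ₀.rank = k
  firstStage : ∀ l j, |Γ₀ l j| ≤ B₃

/-- The matrix whose rows are `w_s, …, w_{s+N-1}`, for indices starting from `0`. -/
def block {d : ℕ} (s N : ℕ) (w : ℕ → Ω → Fin d → ℝ) (ω : Ω) : Matrix (Fin N) (Fin d) ℝ :=
  Matrix.of fun i => w (s + i) ω

/-- The vector with entries `w_s, …, w_{s+N-1}`. -/
def blockVec (s N : ℕ) (w : ℕ → Ω → ℝ) (ω : Ω) : Fin N → ℝ :=
  fun i => w (s + i) ω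

/-- The projection matrix `P_Z = Z (Z'Z)⁻¹ Z'`. -/
def projMatrix (Z : Matrix (Fin N) (Fin m) ℝ) : Matrix (Fin N) (Fin N) ℝ :=
  Z * (Zᵀ * Z)⁻¹ * Zᵀ

/-- The IV objective `(1 / 2N) (Y - Xβ)' P_Z (Y - Xβ)`. -/
def ivObjective (Y : Fin N → ℝ) (X : Matrix (Fin N) (Fin k) ℝ) (Z : Matrix (Fin N) (Fin m) ℝ)
    (β : Fin k → ℝ) : ℝ :=
  1 / (2 * (N : ℝ)) * ((Y - X *ᵥ β) ⬝ᵥ (projMatrix Z *ᵥ (Y - X *ᵥ β)))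

/-- The ridge objective `(1 / 2N) (Y - Xβ)' P_Z (Y - Xβ) + (α / 2) (β - βᵖ)'(β - βᵖ)`. -/
def ridgeObjective (Y : Fin N → ℝ) (X : Matrix (Fin N) (Fin k) ℝ)
    (Z : Matrix (Fin N) (Fin m) ℝ) (βp : Fin k → ℝ) (α : ℝ) (β : Fin k → ℝ) : ℝ :=
  ivObjective Y X Z β + α / 2 * ((β - βp) ⬝ᵥ (β - βp))

/-- The size `[τ n]` of the training sample. -/
def trainSize (τ : ℝ) (n : ℕ) : ℕ := ⌊τ * n⌋₊

/-- The ridge objective of the training sample, the first `[τ n]` observations. -/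
def trainObjective (τ : ℝ) (n : ℕ) (y : ℕ → Ω → ℝ) (x : ℕ → Ω → Fin k → ℝ)
    (z : ℕ → Ω → Fin m → ℝ) (βp : Fin k → ℝ) (ω : Ω) (α : ℝ) (β : Fin k → ℝ) : ℝ :=
  ridgeObjective (blockVec 0 (trainSize τ n) y ω) (block 0 (trainSize τ n) x ω)
    (block 0 (trainSize τ n) z ω) βp α β

/-- The IV objective of the test sample, the last `n - [τ n]` observations. -/
def testObjective (τ : ℝ) (n : ℕ) (y : ℕ → Ω → ℝ) (x : ℕ → Ω → Fin k → ℝ)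
    (z : ℕ → Ω → Fin m → ℝ) (ω : Ω) (β : Fin k → ℝ) : ℝ :=
  ivObjective (blockVec (trainSize τ n) (n - trainSize τ n) y ω)
    (block (trainSize τ n) (n - trainSize τ n) x ω)
    (block (trainSize τ n) (n - trainSize τ n) z ω) β

/-- `a` is a minimizer of `f` over `A`, that is `a ∈ argmin_A f`. -/
def IsArgmin {E : Type*} (f : E → ℝ) (A : Set E) (a : E) : Prop :=
  a ∈ A ∧ IsMinOn f A a

/-- `βhat n ω α` is, for every `α ≥ 0`, a minimizer of the ridge objective of the training
sample (the unique one unless `α = 0` and the objective is not strictly convex). -/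
def IsRidgePath (τ : ℝ) (y : ℕ → Ω → ℝ) (x : ℕ → Ω → Fin k → ℝ)
    (z : ℕ → Ω → Fin m → ℝ) (βp : Fin k → ℝ) (βhat : ℕ → Ω → ℝ → Fin k → ℝ) : Prop :=
  ∀ n ω α, 0 ≤ α → IsArgmin (trainObjective τ n y x z βp ω α) Set.univ (βhat n ω α)

/-- `αhat n ω` minimizes over `A` the test objective along the path `βhat n ω`. On a sample for
which no minimizer exists, `αhat n ω` is an arbitrary number. -/
def IsTuningParameter (τ : ℝ) (y : ℕ → Ω → ℝ) (x : ℕ → Ω → Fin k → ℝ)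
    (z : ℕ → Ω → Fin m → ℝ) (βhat : ℕ → Ω → ℝ → Fin k → ℝ) (A : Set ℝ)
    (αhat : ℕ → Ω → ℝ) : Prop :=
  ∀ n ω, (∃ a, IsArgmin (fun α => testObjective τ n y x z ω (βhat n ω α)) A a) →
    IsArgmin (fun α => testObjective τ n y x z ω (βhat n ω α)) A (αhat n ω)

/-- `W_n = O_p(1)`. -/
def BoundedInProbability (P : Measure Ω) (W : ℕ → Ω → ℝ) : Prop :=
  ∀ η : ENNReal, 0 < η → ∃ C : ℝ, ∀ᶠ n in atTop, P {ω | C < |W n ω|} ≤ η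

end

end RidgePath

/-! In the coordinates `v = β - β₀`, and with `Z'Z / N` invertible, both IV objectives are quadratic
losses `½⟪t - G v, W (t - G v)⟫` with `G = Z'X / N`, `W = (Z'Z / N)⁻¹` and `t = Z'ε / N`; the prior
becomes `δ = βp - β₀ ≠ 0`. When the sample moments are within a small `r` of their limits, `G` and
`W` are bounded above and below by fixed constants, and `‖t‖ ≤ ρ` with `ρ` of order `r`.

The core is deterministic (`le_tuningRate`). The unpenalized training estimator has `v 0 = O(ρ)`, so
its test loss is `O(ρ²)`. Any `α` that does no worse on the test sample therefore has `v α = O(ρ)`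
(`norm_le_of_quadLoss_le`). The first order condition of the training problem, tested against `δ`,
reads `α ⟪δ, δ - v α⟫ = ⟪G δ, W (G (v α) - t)⟫`. The right side is `O(ρ)`, and the inner product on
the left is at least `‖δ‖² / 2` once `v α` is small. Hence `α = O(ρ)`: a nonnegligible penalty would
pull the estimator visibly towards a wrong prior. The same bound confines the minimization to a
compact set, so a minimizer exists.

The probabilistic part is Chebyshev's inequality (`exists_measure_not_momentsNear_le`): on both
subsamples `r` can be taken of order `n^{-1/2}` with probability close to one. This gives the rate,
and the rate gives consistency. -/

namespace RidgePath

/-! ### Deterministic analysis of the penalized quadratic loss. -/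

section Quadratic

variable {E F : Type*} [NormedAddCommGroup E] [InnerProductSpace ℝ E]
  [NormedAddCommGroup F] [InnerProductSpace ℝ F]

/-- The generalized least squares objective `½ ⟪t - G v, W (t - G v)⟫`. -/
noncomputable def quadLoss (G : E →L[ℝ] F) (W : F →L[ℝ] F) (t : F) (v : E) : ℝ :=
  1 / 2 * inner ℝ (t - G v) (W (t - G v))

/-- The operators `G` and `W` are bounded by `C`, and bounded below by `c`. -/
structure IsWellConditioned (c C : ℝ) (G : E →L[ℝ] F) (W : F →L[ℝ] F) : Prop where
  symm : ∀ x y, inner ℝ (W x) y = inner ℝ x (W y)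
  le_inner : ∀ x, c * ‖x‖ ^ 2 ≤ inner ℝ x (W x)
  norm_weight_le : ∀ x, ‖W x‖ ≤ C * ‖x‖
  le_norm : ∀ v, c * ‖v‖ ≤ ‖G v‖
  norm_le : ∀ v, ‖G v‖ ≤ C * ‖v‖

lemma eq_zero_of_forall_linear_add_sq_nonneg {a b : ℝ} (h : ∀ s : ℝ, 0 ≤ s * a + s ^ 2 * b) :
    a = 0 := by
  by_contra ha
  have hb : 0 < |b| + 1 := by positivity
  -- Using `|b| + 1` in place of `b` covers every sign of `b`, including `b = 0`, and still makes
  -- the expression negative.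
  have h1 := h (-a / (|b| + 1))
  have h2 : -a / (|b| + 1) * a + (-a / (|b| + 1)) ^ 2 * b
      = a ^ 2 / (|b| + 1) ^ 2 * (b - (|b| + 1)) := by
    field_simp
    ring
  rw [h2] at h1
  have h3 : 0 < a ^ 2 / (|b| + 1) ^ 2 := by positivity
  have h4 : b - (|b| + 1) < 0 := by linarith [le_abs_self b]
  nlinarith

/-- The first order condition for a minimizer of the penalized objective. -/
lemma firstOrderCondition {G : E →L[ℝ] F} {W : F →L[ℝ] F}
    (hW : ∀ x y, inner ℝ (W x) y = inner ℝ x (W y)) {t : F} {δ v : E} {α : ℝ}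
    (hmin : ∀ w, quadLoss G W t v + α / 2 * ‖v - δ‖ ^ 2
      ≤ quadLoss G W t w + α / 2 * ‖w - δ‖ ^ 2) (d : E) :
    inner ℝ (G d) (W (G v - t)) + α * inner ℝ d (v - δ) = 0 := by
  apply eq_zero_of_forall_linear_add_sq_nonneg
    (b := 1 / 2 * inner ℝ (G d) (W (G d)) + α / 2 * ‖d‖ ^ 2)
  intro s
  have h := hmin (v + s • d)
  have e1 : t - G (v + s • d) = (t - G v) - s • G d := by
    rw [map_add, map_smul]; abel
  have e2 : v + s • d - δ = (v - δ) + s • d := by abel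
  have e3 : ∀ a b : F, inner ℝ (a - s • b) (W (a - s • b))
      = inner ℝ a (W a) - 2 * s * inner ℝ b (W a) + s ^ 2 * inner ℝ b (W b) := by
    intro a b
    have hab : inner ℝ a (W b) = inner ℝ b (W a) := by rw [← hW, real_inner_comm]
    simp only [map_sub, map_smul, inner_sub_left, inner_sub_right, inner_smul_left,
      inner_smul_right, conj_trivial, hab]
    ring
  have e4 : W (G v - t) = - W (t - G v) := by rw [← map_neg, neg_sub]
  unfold quadLoss at h
  rw [e1, e2, e3, norm_add_sq_real, inner_smul_right, norm_smul, mul_pow, Real.norm_eq_abs,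
    sq_abs, real_inner_comm d (v - δ)] at h
  rw [e4, inner_neg_right]
  nlinarith

variable {G G₁ G₂ : E →L[ℝ] F} {W W₁ W₂ : F →L[ℝ] F} {t t₁ t₂ : F} {δ : E} {c C ρ : ℝ}

/-- The normal equation gives `c ‖G v‖² ≤ ⟪G v, W t⟫ ≤ C ‖G v‖ ‖t‖`; the lower bound on `G` then
costs a second factor `c`. -/
lemma norm_le_of_unpenalized (hc : 0 < c) (hG : IsWellConditioned c C G W)
    (hC : 0 < C) {v : E} (hv : inner ℝ (G v) (W (G v - t)) = 0) :
    ‖v‖ ≤ C / c ^ 2 * ‖t‖ := by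
  rw [map_sub, inner_sub_right, sub_eq_zero] at hv
  have h1 := hG.le_inner (G v)
  rw [hv] at h1
  have h2 : inner ℝ (G v) (W t) ≤ ‖G v‖ * (C * ‖t‖) :=
    (real_inner_le_norm _ _).trans (by gcongr; exact hG.norm_weight_le t)
  have h3 : c * ‖G v‖ ≤ C * ‖t‖ := by
    rcases (norm_nonneg (G v)).eq_or_lt with h | h
    · rw [← h]; simp; positivity
    · nlinarith
  have h4 := hG.le_norm v
  rw [div_mul_eq_mul_div, le_div_iff₀ (by positivity)]
  nlinarith

/-- The Lipschitz-type bound for the path of penalized minimizers. -/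
lemma norm_sub_le_of_firstOrderCondition (hc : 0 < c) (hG : IsWellConditioned c C G W)
    {α α' : ℝ} (hα : 0 ≤ α) {v v' : E}
    (hv : ∀ d, inner ℝ (G d) (W (G v - t)) + α * inner ℝ d (v - δ) = 0)
    (hv' : ∀ d, inner ℝ (G d) (W (G v' - t)) + α' * inner ℝ d (v' - δ) = 0) :
    ‖v - v'‖ ≤ |α' - α| * ‖v' - δ‖ / c ^ 3 := by
  -- Both conditions are tested against `d` itself. Their difference is `⟪G d, W (G d)⟫ + α ‖d‖² =
  -- (α' - α) ⟪d, v' - δ⟫`, and the penalty term on the left is dropped.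
  set d := v - v' with hd
  have h1 := hv d
  have h2 := hv' d
  have e1 : G v - t = G d + (G v' - t) := by rw [hd, map_sub]; abel
  have e2 : v - δ = d + (v' - δ) := by rw [hd]; abel
  rw [e1, e2, map_add, inner_add_right, inner_add_right, real_inner_self_eq_norm_sq] at h1
  have h3 : c * (c * ‖d‖) ^ 2 ≤ inner ℝ (G d) (W (G d)) :=
    le_trans (by gcongr; exact hG.le_norm d) (hG.le_inner (G d))
  have h4 : (α' - α) * inner ℝ d (v' - δ) ≤ |α' - α| * (‖d‖ * ‖v' - δ‖) := by
    refine (le_abs_self _).trans ?_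
    rw [abs_mul]
    gcongr
    exact abs_real_inner_le_norm _ _
  have h5 : c ^ 3 * ‖d‖ ^ 2 ≤ |α' - α| * ‖v' - δ‖ * ‖d‖ := by nlinarith [sq_nonneg ‖d‖]
  rw [le_div_iff₀ (by positivity)]
  rcases (norm_nonneg d).eq_or_lt with h | h
  · rw [← h]; simp; positivity
  · nlinarith

/-- The constant `c ^ 3` comes from `G` and `W`, not from the penalty, so the Lipschitz-type bound
survives down to `α = 0`. -/
lemma continuousOn_ridgePath (hc : 0 < c) (hG : IsWellConditioned c C G W) {v : ℝ → E}
    (hv : ∀ α, 0 ≤ α → ∀ d, inner ℝ (G d) (W (G (v α) - t)) + α * inner ℝ d (v α - δ) = 0) :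
    ContinuousOn v (Set.Ici 0) := by
  intro a ha
  rw [ContinuousWithinAt, tendsto_iff_norm_sub_tendsto_zero]
  have h : Tendsto (fun α : ℝ => |a - α| * ‖v a - δ‖ / c ^ 3) (𝓝[Set.Ici 0] a) (𝓝 0) := by
    have : Continuous fun α : ℝ => |a - α| * ‖v a - δ‖ / c ^ 3 := by fun_prop
    have h := (this.tendsto a).mono_left (nhdsWithin_le_nhds (s := Set.Ici 0))
    simpa using h
  refine squeeze_zero' (Eventually.of_forall fun _ => norm_nonneg _) ?_ h
  filter_upwards [self_mem_nhdsWithin] with α hα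
  exact norm_sub_le_of_firstOrderCondition hc hG hα (hv α hα) (hv a ha)

/-- The rate at which a parameter of small loss approaches the truth. -/
noncomputable def lossRate (c C : ℝ) : ℝ := (1 + C / c * (1 + C * (C / c ^ 2))) / c

lemma lossRate_pos (hc : 0 < c) (hC : 0 < C) : 0 < lossRate c C := by
  unfold lossRate; positivity

/-- The residual at `w` is `O(ρ)`. The loss is comparable to the squared residual, so the residual
at `v` is `O(ρ)` too; adding back `t` and using the lower bound on `G` bounds `v`. -/
lemma norm_le_of_quadLoss_le (hc : 0 < c) (hcC : c ≤ C)
    (hG : IsWellConditioned c C G W) (ht : ‖t‖ ≤ ρ) {v w : E} (hw : ‖w‖ ≤ C / c ^ 2 * ρ)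
    (hvw : quadLoss G W t v ≤ quadLoss G W t w) : ‖v‖ ≤ lossRate c C * ρ := by
  have hC : 0 < C := hc.trans_le hcC
  unfold quadLoss at hvw
  have h1 := hG.le_inner (t - G v)
  have h2 : inner ℝ (t - G w) (W (t - G w)) ≤ C * ‖t - G w‖ ^ 2 := by
    refine (real_inner_le_norm _ _).trans ?_
    nlinarith [hG.norm_weight_le (t - G w), norm_nonneg (t - G w)]
  have h3 : ‖t - G v‖ ≤ C / c * ‖t - G w‖ := by
    refine (sq_le_sq₀ (norm_nonneg _) (by positivity)).1 ?_
    have h4 : ‖t - G v‖ ^ 2 ≤ C / c * ‖t - G w‖ ^ 2 := by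
      rw [div_mul_eq_mul_div, le_div_iff₀ hc]
      linarith
    -- Since `C / c ≥ 1`, its square root may be replaced by `C / c` itself.
    have h5 : 1 ≤ C / c := (one_le_div hc).2 hcC
    rw [mul_pow]
    refine h4.trans ?_
    gcongr
    nlinarith
  have h6 : ‖t - G w‖ ≤ ρ + C * (C / c ^ 2 * ρ) :=
    (norm_sub_le _ _).trans (add_le_add ht ((hG.norm_le w).trans (by gcongr)))
  have h7 : ‖G v‖ ≤ ‖t‖ + ‖t - G v‖ := by
    have : G v = t - (t - G v) := by abel
    calc ‖G v‖ = ‖t - (t - G v)‖ := by rw [← this]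
      _ ≤ _ := norm_sub_le _ _
  have h8 : C / c * ‖t - G w‖ ≤ C / c * (ρ + C * (C / c ^ 2 * ρ)) := by gcongr
  have h9 := hG.le_norm v
  unfold lossRate
  rw [div_mul_eq_mul_div, le_div_iff₀ hc]
  nlinarith

/-- The rate of a tuning parameter whose test loss is at most that of the unpenalized estimator. -/
noncomputable def tuningRate (c C r : ℝ) : ℝ := 2 * C ^ 2 * (C * lossRate c C + 1) / r

lemma tuningRate_nonneg {r : ℝ} (hc : 0 < c) (hC : 0 < C) (hr : 0 ≤ r) :
    0 ≤ tuningRate c C r := by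
  have := lossRate_pos hc hC
  unfold tuningRate; positivity

/-- The first order condition is tested against `δ`. The smallness `hρ` keeps `v α` within `‖δ‖ / 2`
of the truth, so the penalty gradient along `δ` cannot vanish and must be balanced by a fit term of
order `ρ`. -/
lemma le_tuningRate (hc : 0 < c) (hcC : c ≤ C) (hδ : δ ≠ 0) (h₁ : IsWellConditioned c C G₁ W₁)
    (h₂ : IsWellConditioned c C G₂ W₂) (ht₁ : ‖t₁‖ ≤ ρ) (ht₂ : ‖t₂‖ ≤ ρ)
    (hρ : lossRate c C * ρ ≤ ‖δ‖ / 2) {v : ℝ → E}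
    (hv : ∀ α, 0 ≤ α →
      ∀ d, inner ℝ (G₁ d) (W₁ (G₁ (v α) - t₁)) + α * inner ℝ d (v α - δ) = 0)
    {α : ℝ} (hα : 0 ≤ α) (hle : quadLoss G₂ W₂ t₂ (v α) ≤ quadLoss G₂ W₂ t₂ (v 0)) :
    α ≤ tuningRate c C ‖δ‖ * ρ := by
  have hC : 0 < C := hc.trans_le hcC
  have hδ' : 0 < ‖δ‖ := norm_pos_iff.2 hδ
  have hv0 : ‖v 0‖ ≤ C / c ^ 2 * ρ := by
    refine (norm_le_of_unpenalized (t := t₁) hc h₁ hC ?_).trans (by gcongr)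
    simpa using hv 0 le_rfl (v 0)
  have hvα := norm_le_of_quadLoss_le hc hcC h₂ ht₂ hv0 hle
  have h := hv α hα δ
  have h3 : inner ℝ (G₁ δ) (W₁ (G₁ (v α) - t₁))
      ≤ (C * ‖δ‖) * (C * (C * (lossRate c C * ρ) + ρ)) := by
    refine (real_inner_le_norm _ _).trans ?_
    gcongr
    · exact h₁.norm_le δ
    · refine (h₁.norm_weight_le _).trans ?_
      gcongr
      refine (norm_sub_le _ _).trans (add_le_add ((h₁.norm_le _).trans ?_) ht₁)
      gcongr
  have h4 : ‖δ‖ ^ 2 / 2 ≤ - inner ℝ δ (v α - δ) := by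
    rw [inner_sub_right, real_inner_self_eq_norm_sq]
    have := real_inner_le_norm δ (v α)
    nlinarith
  have h5 : α * (‖δ‖ ^ 2 / 2) ≤ (C * ‖δ‖) * (C * (C * (lossRate c C * ρ) + ρ)) :=
    (mul_le_mul_of_nonneg_left h4 hα).trans (by linarith)
  unfold tuningRate
  rw [div_mul_eq_mul_div, le_div_iff₀ hδ']
  nlinarith

lemma continuous_quadLoss (G : E →L[ℝ] F) (W : F →L[ℝ] F) (t : F) :
    Continuous (quadLoss G W t) := by
  unfold quadLoss
  fun_prop

/-- A minimizer of the test loss along the path exists. -/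
lemma exists_isArgmin_quadLoss (hc : 0 < c) (hcC : c ≤ C) (hδ : δ ≠ 0)
    (h₁ : IsWellConditioned c C G₁ W₁)
    (h₂ : IsWellConditioned c C G₂ W₂) (ht₁ : ‖t₁‖ ≤ ρ) (ht₂ : ‖t₂‖ ≤ ρ)
    (hρ : lossRate c C * ρ ≤ ‖δ‖ / 2) {v : ℝ → E}
    (hv : ∀ α, 0 ≤ α →
      ∀ d, inner ℝ (G₁ d) (W₁ (G₁ (v α) - t₁)) + α * inner ℝ d (v α - δ) = 0)
    {A : Set ℝ} (hA : IsClosed A) (hA₀ : 0 ∈ A) (hA' : A ⊆ Set.Ici 0) :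
    ∃ a, IsArgmin (fun α => quadLoss G₂ W₂ t₂ (v α)) A a := by
  have hcont : ContinuousOn (fun α => quadLoss G₂ W₂ t₂ (v α)) A :=
    (continuous_quadLoss G₂ W₂ t₂).comp_continuousOn ((continuousOn_ridgePath hc h₁ hv).mono hA')
  -- Beyond the bound of `le_tuningRate` the loss exceeds its value at `0`, which replaces
  -- compactness when `A` is unbounded.
  obtain ⟨a, haA, ha⟩ := hcont.exists_isMinOn' hA hA₀ (by
    rw [eventually_inf_principal]
    filter_upwards [(isCompact_Icc (a := 0) (b := tuningRate c C ‖δ‖ * ρ)).compl_mem_cocompact]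
      with α hα hαA
    by_contra! hlt
    exact hα ⟨hA' hαA, le_tuningRate hc hcC hδ h₁ h₂ ht₁ ht₂ hρ hv (hA' hαA) hlt.le⟩)
  exact ⟨a, haA, ha⟩

end Quadratic

/-! ### Uniform conditioning near the population moments. -/

section Conditioning

/-- The operator between Euclidean spaces given by a matrix. -/
noncomputable def matrixOp {k m : ℕ} (M : Matrix (Fin m) (Fin k) ℝ) :
    EuclideanSpace ℝ (Fin k) →L[ℝ] EuclideanSpace ℝ (Fin m) :=
  LinearMap.toContinuousLinearMap (Matrix.toEuclideanLin M)

lemma matrixOp_apply {k m : ℕ} (M : Matrix (Fin m) (Fin k) ℝ) (v : EuclideanSpace ℝ (Fin k)) :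
    matrixOp M v = WithLp.toLp 2 (M *ᵥ v.ofLp) := rfl

lemma continuous_matrixOp {k m : ℕ} : Continuous (matrixOp (k := k) (m := m)) :=
  LinearMap.continuous_of_finiteDimensional
    ((Matrix.toEuclideanLin (𝕜 := ℝ) (m := Fin m) (n := Fin k)).trans
      LinearMap.toContinuousLinearMap).toLinearMap

lemma exists_le_inner_of_pos {F : Type*} [NormedAddCommGroup F] [InnerProductSpace ℝ F]
    [FiniteDimensional ℝ F] (W : F →L[ℝ] F) (hW : ∀ x, x ≠ 0 → 0 < inner ℝ x (W x)) :
    ∃ c > 0, ∀ x, c * ‖x‖ ^ 2 ≤ inner ℝ x (W x) := by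
  rcases subsingleton_or_nontrivial F with hF | hF
  · exact ⟨1, one_pos, fun x => by simp [Subsingleton.elim x 0]⟩
  have : ProperSpace F := FiniteDimensional.proper ℝ F
  obtain ⟨x₀, hx₀, hmin⟩ := (isCompact_sphere (0 : F) 1).exists_isMinOn
    (NormedSpace.sphere_nonempty.2 zero_le_one)
    (f := fun x => inner ℝ x (W x)) (by fun_prop)
  have hx₀' : ‖x₀‖ = 1 := by simpa using hx₀
  refine ⟨inner ℝ x₀ (W x₀), hW x₀ (by rintro rfl; simp at hx₀'), fun x => ?_⟩
  rcases eq_or_ne x 0 with rfl | hx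
  · simp
  have hx' : ‖x‖ ≠ 0 := norm_ne_zero_iff.2 hx
  have h := hmin (a := ‖x‖⁻¹ • x) (by simp [norm_smul, hx'])
  simp only [Set.mem_ofPred_eq, map_smul, inner_smul_left, inner_smul_right, conj_trivial] at h
  calc inner ℝ x₀ (W x₀) * ‖x‖ ^ 2 ≤ (‖x‖⁻¹ * (‖x‖⁻¹ * inner ℝ x (W x))) * ‖x‖ ^ 2 := by gcongr
    _ = inner ℝ x (W x) := by field_simp

lemma exists_le_norm_of_injective {E F : Type*} [NormedAddCommGroup E] [NormedSpace ℝ E]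
    [FiniteDimensional ℝ E] [NormedAddCommGroup F] [NormedSpace ℝ F] (G : E →L[ℝ] F)
    (hG : Function.Injective G) : ∃ c > 0, ∀ v, c * ‖v‖ ≤ ‖G v‖ := by
  obtain ⟨K, hK, h⟩ := (G : E →ₗ[ℝ] F).injective_iff_antilipschitz.1 hG
  refine ⟨(K : ℝ)⁻¹, by positivity, fun v => ?_⟩
  have := h.le_mul_dist v 0
  simp only [dist_zero_right, map_zero, ContinuousLinearMap.coe_coe] at this
  rw [inv_mul_le_iff₀ (by positivity)]
  exact this

/-- Operators close to a positive definite weight and an injective design are uniformly well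
conditioned. -/
lemma exists_isWellConditioned {E F : Type*} [NormedAddCommGroup E] [InnerProductSpace ℝ E]
    [NormedAddCommGroup F] [InnerProductSpace ℝ F] [FiniteDimensional ℝ E]
    [FiniteDimensional ℝ F] (G₀ : E →L[ℝ] F) (W₀ : F →L[ℝ] F) (hG₀ : Function.Injective G₀)
    (hW₀ : ∀ x, x ≠ 0 → 0 < inner ℝ x (W₀ x)) :
    ∃ c > 0, ∃ C ≥ c, ∀ᶠ p : (E →L[ℝ] F) × (F →L[ℝ] F) in 𝓝 (G₀, W₀),
      (∀ x y, inner ℝ (p.2 x) y = inner ℝ x (p.2 y)) → IsWellConditioned c C p.1 p.2 := by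
  obtain ⟨a, ha, hGa⟩ := exists_le_norm_of_injective G₀ hG₀
  obtain ⟨b, hb, hWb⟩ := exists_le_inner_of_pos W₀ hW₀
  -- With half of the limiting lower bounds, a perturbation of operator norm at most `c` still
  -- leaves `c`.
  set c := min a b / 2 with hc
  have hc0 : 0 < c := by positivity
  have hca : 2 * c ≤ a := by have := min_le_left a b; linarith
  have hcb : 2 * c ≤ b := by have := min_le_right a b; linarith
  refine ⟨c, hc0, ‖G₀‖ + ‖W₀‖ + c, ?_, ?_⟩
  · have := norm_nonneg G₀; have := norm_nonneg W₀; linarith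
  filter_upwards [Metric.ball_mem_nhds (G₀, W₀) hc0] with p hp hsymm
  rw [Metric.mem_ball, Prod.dist_eq, max_lt_iff, dist_eq_norm, dist_eq_norm] at hp
  have key₁ : ∀ v, ‖p.1 v - G₀ v‖ ≤ c * ‖v‖ := fun v =>
    ((p.1 - G₀).le_opNorm v).trans (by gcongr; exact hp.1.le)
  have key₂ : ∀ x, ‖p.2 x - W₀ x‖ ≤ c * ‖x‖ := fun x =>
    ((p.2 - W₀).le_opNorm x).trans (by gcongr; exact hp.2.le)
  refine ⟨hsymm, fun x => ?_, fun x => ?_, fun v => ?_, fun v => ?_⟩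
  · have h1 : |inner ℝ x (p.2 x - W₀ x)| ≤ ‖x‖ * (c * ‖x‖) :=
      (abs_real_inner_le_norm _ _).trans (by gcongr; exact key₂ x)
    rw [inner_sub_right] at h1
    have h2 := (abs_le.1 h1).1
    have h3 := hWb x
    nlinarith [sq_nonneg ‖x‖]
  · have h1 := norm_le_norm_add_norm_sub' (p.2 x) (W₀ x)
    have h2 := W₀.le_opNorm x
    have h3 := key₂ x
    nlinarith [mul_nonneg (norm_nonneg G₀) (norm_nonneg x)]
  · have h1 := norm_le_norm_add_norm_sub (p.1 v) (G₀ v)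
    have h2 := hGa v
    have h3 := key₁ v
    nlinarith [norm_nonneg v]
  · have h1 := norm_le_norm_add_norm_sub' (p.1 v) (G₀ v)
    have h2 := G₀.le_opNorm v
    have h3 := key₁ v
    nlinarith [mul_nonneg (norm_nonneg W₀) (norm_nonneg v)]

lemma inner_matrixOp {m : ℕ} (M : Matrix (Fin m) (Fin m) ℝ) (x y : EuclideanSpace ℝ (Fin m)) :
    inner ℝ x (matrixOp M y) = x.ofLp ⬝ᵥ (M *ᵥ y.ofLp) := by
  rw [matrixOp_apply, EuclideanSpace.inner_eq_star_dotProduct, dotProduct_comm]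
  simp

lemma matrixOp_symm {m : ℕ} {M : Matrix (Fin m) (Fin m) ℝ} (hM : M.IsSymm)
    (x y : EuclideanSpace ℝ (Fin m)) :
    inner ℝ (matrixOp M x) y = inner ℝ x (matrixOp M y) := by
  rw [real_inner_comm, inner_matrixOp, inner_matrixOp, Matrix.dotProduct_mulVec,
    ← Matrix.mulVec_transpose, hM.eq, dotProduct_comm]

/-- `S` stands for `Z'Z / N` and `T` for `Z'U / N`. At the limit `(R, 0)` the design `R * Γ` is
injective and the weight `R⁻¹` is positive definite; continuity of the inverse at `R` extends this
to a neighbourhood. -/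
lemma exists_isWellConditioned_matrixOp {k m : ℕ} {R : Matrix (Fin m) (Fin m) ℝ}
    (hR : R.PosDef) {Γ : Matrix (Fin m) (Fin k) ℝ} (hΓ : Γ.rank = k) :
    ∃ c > 0, ∃ C ≥ c, ∃ r > 0, ∀ (S : Matrix (Fin m) (Fin m) ℝ) (T : Matrix (Fin m) (Fin k) ℝ),
      S.IsSymm → (∀ a b, |S a b - R a b| ≤ r) → (∀ a j, |T a j| ≤ r) →
      IsUnit S.det ∧ IsWellConditioned c C (matrixOp (S * Γ + T)) (matrixOp S⁻¹) := by
  have hdet : R.det ≠ 0 := hR.det_pos.ne'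
  have hΓinj : Function.Injective Γ.mulVec := by
    rw [Matrix.mulVec_injective_iff, linearIndependent_iff_card_eq_finrank_span, Set.finrank,
      ← Matrix.rank_eq_finrank_span_cols, hΓ, Fintype.card_fin]
  have hinj : Function.Injective (matrixOp (R * Γ)) := by
    intro v w hvw
    rw [matrixOp_apply, matrixOp_apply] at hvw
    have h := WithLp.toLp_injective 2 hvw
    rw [← Matrix.mulVec_mulVec, ← Matrix.mulVec_mulVec] at h
    exact WithLp.ofLp_injective 2 (hΓinj (Matrix.mulVec_injective_of_isUnit
      ((Matrix.isUnit_iff_isUnit_det R).2 hdet.isUnit) h))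
  have hpos : ∀ x, x ≠ 0 → 0 < inner ℝ x (matrixOp R⁻¹ x) := by
    intro x hx
    rw [inner_matrixOp]
    have := hR.inv.dotProduct_mulVec_pos (x := x.ofLp) (by simpa using hx)
    simpa using this
  obtain ⟨c, hc, C, hcC, hev⟩ := exists_isWellConditioned _ _ hinj hpos
  have hinv : ContinuousAt (fun S : Matrix (Fin m) (Fin m) ℝ => S⁻¹) R :=
    continuousAt_matrix_inv R (NormedRing.inverse_continuousAt (Units.mk0 _ hdet))
  -- Matrices are treated as plain functions so that the sup metric turns entrywise bounds into a
  -- distance.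
  have hlim : Tendsto (fun q : (Fin m → Fin m → ℝ) × (Fin m → Fin k → ℝ) =>
      (matrixOp (Matrix.of q.1 * Γ + Matrix.of q.2), matrixOp (Matrix.of q.1)⁻¹))
      (𝓝 (R, 0)) (𝓝 (matrixOp (R * Γ), matrixOp R⁻¹)) := by
    refine Tendsto.prodMk_nhds ?_ ?_
    · have : Continuous fun q : (Fin m → Fin m → ℝ) × (Fin m → Fin k → ℝ) =>
          matrixOp (Matrix.of q.1 * Γ + Matrix.of q.2) :=
        continuous_matrixOp.comp (by
          refine Continuous.add (Continuous.matrix_mul ?_ continuous_const) ?_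
          · exact continuous_fst
          · exact continuous_snd)
      have h := this.tendsto (R, 0)
      have e : Matrix.of (R : Fin m → Fin m → ℝ) * Γ + Matrix.of (0 : Fin m → Fin k → ℝ)
        = R * Γ := add_zero _
      rwa [e] at h
    · exact (continuous_matrixOp.continuousAt.comp (hinv.comp_of_eq
        (f := fun q : (Fin m → Fin m → ℝ) × (Fin m → Fin k → ℝ) => Matrix.of q.1)
        continuous_fst.continuousAt rfl)).tendsto
  have hdet' : ∀ᶠ q : (Fin m → Fin m → ℝ) × (Fin m → Fin k → ℝ) in 𝓝 (R, 0),
      (Matrix.of q.1).det ≠ 0 := by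
    have : Continuous fun q : (Fin m → Fin m → ℝ) × (Fin m → Fin k → ℝ) =>
        (Matrix.of q.1).det := Continuous.matrix_det continuous_fst
    exact this.continuousAt.eventually_ne hdet
  obtain ⟨r, hr, hball⟩ := Metric.eventually_nhds_iff.1 (hdet'.and (hlim.eventually hev))
  refine ⟨c, hc, C, hcC, r / 2, by positivity, fun S T hS hSR hT => ?_⟩
  have hd : dist ((S, T) : (Fin m → Fin m → ℝ) × (Fin m → Fin k → ℝ)) (R, 0) < r := by
    rw [Prod.dist_eq, max_lt_iff, dist_pi_lt_iff hr, dist_pi_lt_iff hr]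
    refine ⟨fun a => (dist_pi_lt_iff hr).2 fun b => ?_,
      fun a => (dist_pi_lt_iff hr).2 fun j => ?_⟩
    · rw [Real.dist_eq]; exact (hSR a b).trans_lt (by linarith)
    · rw [Real.dist_eq]; simpa using (hT a j).trans_lt (by linarith)
  obtain ⟨h1, h2⟩ := hball hd
  refine ⟨IsUnit.mk0 _ h1, h2 (matrixOp_symm ?_)⟩
  rw [Matrix.IsSymm, Matrix.transpose_nonsing_inv]
  exact congrArg _ hS.eq

end Conditioning

/-! ### From the IV objective to the quadratic loss. -/

section Reduction

/-- The sample moment matrix `W'W̃ / N` of the observations `s, …, s + N - 1`. -/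
noncomputable def sampleMoment {Ω : Type*} {d d' : ℕ} (s N : ℕ) (w : ℕ → Ω → Fin d → ℝ)
    (w' : ℕ → Ω → Fin d' → ℝ) (ω : Ω) : Matrix (Fin d) (Fin d') ℝ :=
  (N : ℝ)⁻¹ • ((block s N w ω)ᵀ * block s N w' ω)

lemma sampleMoment_apply {Ω : Type*} {d d' : ℕ} (s N : ℕ) (w : ℕ → Ω → Fin d → ℝ)
    (w' : ℕ → Ω → Fin d' → ℝ) (ω : Ω) (a : Fin d) (b : Fin d') :
    sampleMoment s N w w' ω a b = (N : ℝ)⁻¹ * ∑ i : Fin N, w (s + i) ω a * w' (s + i) ω b := by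
  simp [sampleMoment, Matrix.mul_apply, block]

lemma sampleMoment_self_isSymm {Ω : Type*} {d : ℕ} (s N : ℕ) (w : ℕ → Ω → Fin d → ℝ) (ω : Ω) :
    (sampleMoment s N w w ω).IsSymm := by
  ext a b
  simp [sampleMoment_apply, mul_comm]

variable {k m N : ℕ}

/-- With `w` the residual, the projection form is `(Z'w)' (Z'Z)⁻¹ (Z'w)`, and `Z'w / N = t - G (β -
β₀)`; the powers of `N` cancel. -/
lemma ivObjective_eq_quadLoss (hN : N ≠ 0) (X : Matrix (Fin N) (Fin k) ℝ)
    (Z : Matrix (Fin N) (Fin m) ℝ) (e : Fin N → ℝ) (β₀ β : Fin k → ℝ)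
    (hS : IsUnit ((N : ℝ)⁻¹ • (Zᵀ * Z)).det) :
    ivObjective (X *ᵥ β₀ + e) X Z β =
      quadLoss (matrixOp ((N : ℝ)⁻¹ • (Zᵀ * X))) (matrixOp ((N : ℝ)⁻¹ • (Zᵀ * Z))⁻¹)
        (WithLp.toLp 2 ((N : ℝ)⁻¹ • (Zᵀ *ᵥ e))) (WithLp.toLp 2 (β - β₀)) := by
  have hN' : (N : ℝ) ≠ 0 := Nat.cast_ne_zero.2 hN
  set S := (N : ℝ)⁻¹ • (Zᵀ * Z) with hSdef
  have hZ : (Zᵀ * Z)⁻¹ = (N : ℝ)⁻¹ • S⁻¹ := by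
    have : Zᵀ * Z = Units.mk0 (N : ℝ) hN' • S := by
      rw [hSdef, Units.smul_mk0, smul_smul, mul_inv_cancel₀ hN', one_smul]
    rw [this, Matrix.inv_smul' _ _ hS]
    rfl
  set w := X *ᵥ β₀ + e - X *ᵥ β with hw
  have hw' : w = e - X *ᵥ (β - β₀) := by rw [hw, Matrix.mulVec_sub]; abel
  have hres : WithLp.toLp 2 ((N : ℝ)⁻¹ • (Zᵀ *ᵥ e))
      - matrixOp ((N : ℝ)⁻¹ • (Zᵀ * X)) (WithLp.toLp 2 (β - β₀))
      = WithLp.toLp 2 ((N : ℝ)⁻¹ • (Zᵀ *ᵥ w)) := by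
    rw [matrixOp_apply, ← WithLp.toLp_sub, Matrix.smul_mulVec, ← smul_sub,
      ← Matrix.mulVec_mulVec, ← Matrix.mulVec_sub, hw']
  unfold quadLoss ivObjective projMatrix
  rw [hres, inner_matrixOp, ← hw, hZ, ← Matrix.mulVec_mulVec, ← Matrix.mulVec_mulVec,
    Matrix.dotProduct_mulVec w Z, ← Matrix.mulVec_transpose, Matrix.smul_mulVec,
    Matrix.mulVec_smul, smul_dotProduct, dotProduct_smul]
  simp only [smul_eq_mul]
  field_simp

/-- The errors in the first-stage equation, as columns of the sample moments. -/
lemma sampleMoment_regressor {Ω : Type*} [MeasurableSpace Ω] (s N : ℕ)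
    (Γ₀ : Matrix (Fin m) (Fin k) ℝ)
    (z : ℕ → Ω → Fin m → ℝ) (ε : ℕ → Ω → ℝ) (u : ℕ → Ω → Fin k → ℝ) (ω : Ω) :
    sampleMoment s N z (regressor Γ₀ z u) ω = sampleMoment s N z z ω * Γ₀
      + (sampleMoment s N z (errorVec ε u) ω).submatrix id Fin.succ := by
  have h : block s N (regressor Γ₀ z u) ω
      = block s N z ω * Γ₀ + (block s N (errorVec ε u) ω).submatrix id Fin.succ := by
    ext i j
    simp [block, regressor, errorVec, Matrix.mul_apply, Matrix.vecMul, dotProduct]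
  rw [sampleMoment, h, Matrix.mul_add, smul_add, sampleMoment, sampleMoment, Matrix.smul_mul,
    Matrix.mul_assoc]
  rfl

/-- One moment matrix of instruments with errors carries all the noise: column `0` is the score `t`,
the columns `Fin.succ j` perturb the design. -/
lemma ivObjective_block_eq_quadLoss {Ω : Type*} [MeasurableSpace Ω] (hN : N ≠ 0) (s : ℕ)
    (β₀ β : Fin k → ℝ) (Γ₀ : Matrix (Fin m) (Fin k) ℝ)
    (z : ℕ → Ω → Fin m → ℝ) (ε : ℕ → Ω → ℝ) (u : ℕ → Ω → Fin k → ℝ) (ω : Ω)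
    (hS : IsUnit (sampleMoment s N z z ω).det) :
    ivObjective (blockVec s N (response β₀ Γ₀ z ε u) ω) (block s N (regressor Γ₀ z u) ω)
        (block s N z ω) β =
      quadLoss (matrixOp (sampleMoment s N z z ω * Γ₀
          + (sampleMoment s N z (errorVec ε u) ω).submatrix id Fin.succ))
        (matrixOp (sampleMoment s N z z ω)⁻¹)
        (WithLp.toLp 2 fun a => sampleMoment s N z (errorVec ε u) ω a 0)
        (WithLp.toLp 2 (β - β₀)) := by
  have hY : blockVec s N (response β₀ Γ₀ z ε u) ω
      = block s N (regressor Γ₀ z u) ω *ᵥ β₀ + blockVec s N ε ω := rfl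
  have ht : (fun a => sampleMoment s N z (errorVec ε u) ω a 0)
      = (N : ℝ)⁻¹ • ((block s N z ω)ᵀ *ᵥ blockVec s N ε ω) := by
    ext a
    simp [sampleMoment_apply, Matrix.mulVec, dotProduct, block, blockVec, errorVec]
  rw [hY, ivObjective_eq_quadLoss hN _ _ _ _ _ hS, ht, ← sampleMoment_regressor]
  rfl

end Reduction

/-! ### Bound on the tuning parameter on good samples. -/

section Deterministic

variable {Ω : Type*} [MeasurableSpace Ω] {k m : ℕ}

/-- The sample moments of the observations `s, …, s + N - 1` are within `r` of their limits. -/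
def MomentsNear (R : Matrix (Fin m) (Fin m) ℝ) (z : ℕ → Ω → Fin m → ℝ) (ε : ℕ → Ω → ℝ)
    (u : ℕ → Ω → Fin k → ℝ) (s N : ℕ) (r : ℝ) (ω : Ω) : Prop :=
  (∀ a b, |sampleMoment s N z z ω a b - R a b| ≤ r) ∧
    ∀ a j, |sampleMoment s N z (errorVec ε u) ω a j| ≤ r

lemma norm_toLp_le {r : ℝ} (hr : 0 ≤ r) (t : Fin m → ℝ) (ht : ∀ a, |t a| ≤ r) :
    ‖WithLp.toLp 2 t‖ ≤ m * r := by
  rw [EuclideanSpace.norm_eq]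
  refine Real.sqrt_le_iff.2 ⟨by positivity, ?_⟩
  calc ∑ a, ‖(WithLp.toLp 2 t) a‖ ^ 2 ≤ ∑ _a : Fin m, r ^ 2 := by
        gcongr with a
        simpa using ht a
    _ = m * r ^ 2 := by simp
    _ ≤ (m * r) ^ 2 := by
        rcases Nat.eq_zero_or_pos m with h | h
        · simp [h]
        · have : (1 : ℝ) ≤ m := by exact_mod_cast h
          nlinarith [mul_nonneg (sub_nonneg.2 this) (sq_nonneg r), sq_nonneg r,
            mul_nonneg (mul_nonneg (sub_nonneg.2 this) (sq_nonneg r)) (by positivity : (0 : ℝ) ≤ m)]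

/-- On samples whose moments are close to their limits, the tuning parameter is of the order of
the sampling error. -/
lemma exists_tuningParameter_le {R : Matrix (Fin m) (Fin m) ℝ} (hR : R.PosDef)
    {Γ₀ : Matrix (Fin m) (Fin k) ℝ} (hΓ : Γ₀.rank = k) {β₀ βp : Fin k → ℝ} (hprior : βp ≠ β₀)
    (z : ℕ → Ω → Fin m → ℝ) (ε : ℕ → Ω → ℝ) (u : ℕ → Ω → Fin k → ℝ) (τ : ℝ)
    {A : Set ℝ} (hA : IsClosed A) (hA₀ : 0 ∈ A) (hA' : A ⊆ Set.Ici 0)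
    {βhat : ℕ → Ω → ℝ → Fin k → ℝ}
    (hβ : IsRidgePath τ (response β₀ Γ₀ z ε u) (regressor Γ₀ z u) z βp βhat)
    {αhat : ℕ → Ω → ℝ}
    (hα : IsTuningParameter τ (response β₀ Γ₀ z ε u) (regressor Γ₀ z u) z βhat A αhat) :
    ∃ K ≥ 0, ∃ r₀ > 0, ∀ n ω r, trainSize τ n ≠ 0 → n - trainSize τ n ≠ 0 → 0 ≤ r → r ≤ r₀ →
      MomentsNear R z ε u 0 (trainSize τ n) r ω →
      MomentsNear R z ε u (trainSize τ n) (n - trainSize τ n) r ω →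
      |αhat n ω| ≤ K * r := by
  obtain ⟨c, hc, C, hcC, r₁, hr₁, hwell⟩ := exists_isWellConditioned_matrixOp hR hΓ
  have hC : 0 < C := hc.trans_le hcC
  set δ : EuclideanSpace ℝ (Fin k) := WithLp.toLp 2 (βp - β₀) with hδdef
  have hδ : δ ≠ 0 := by
    intro h
    exact hprior (sub_eq_zero.1 ((WithLp.toLp_eq_zero 2).1 h))
  have hδ' : 0 < ‖δ‖ := norm_pos_iff.2 hδ
  have hL := lossRate_pos hc hC
  -- The factor `m` passes from entrywise bounds to the norm of `t`. The threshold secures both the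
  -- conditioning and the smallness required by `le_tuningRate`; `m + 1` avoids dividing by zero
  -- when `m = 0`.
  refine ⟨tuningRate c C ‖δ‖ * m, mul_nonneg (tuningRate_nonneg hc hC hδ'.le) (by positivity),
    min r₁ (‖δ‖ / 2 / (lossRate c C * (m + 1))), by positivity, ?_⟩
  intro n ω r hN₁ hN₂ hr hr₀ hM₁ hM₂
  have hrr₁ : r ≤ r₁ := hr₀.trans (min_le_left _ _)
  have hρ : lossRate c C * (m * r) ≤ ‖δ‖ / 2 := by
    have h := hr₀.trans (min_le_right _ _)
    rw [le_div_iff₀ (by positivity)] at h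
    nlinarith [mul_nonneg hL.le hr]
  have hwell' : ∀ s N, MomentsNear R z ε u s N r ω → _ := fun s N h =>
    hwell (sampleMoment s N z z ω)
      ((sampleMoment s N z (errorVec ε u) ω).submatrix id Fin.succ)
      (sampleMoment_self_isSymm s N z ω) (fun a b => (h.1 a b).trans hrr₁)
      (fun a j => (h.2 a j.succ).trans hrr₁)
  obtain ⟨hS₁, hw₁⟩ := hwell' _ _ hM₁
  obtain ⟨hS₂, hw₂⟩ := hwell' _ _ hM₂
  have ht₁ := norm_toLp_le hr _ fun a => hM₁.2 a 0
  have ht₂ := norm_toLp_le hr _ fun a => hM₂.2 a 0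
  set v : ℝ → EuclideanSpace ℝ (Fin k) := fun α => WithLp.toLp 2 (βhat n ω α - β₀) with hvdef
  have hpen : ∀ β : Fin k → ℝ, (β - βp) ⬝ᵥ (β - βp) = ‖WithLp.toLp 2 (β - β₀) - δ‖ ^ 2 := by
    intro β
    rw [hδdef, ← WithLp.toLp_sub, sub_sub_sub_cancel_right, EuclideanSpace.norm_sq_eq]
    simp [dotProduct, sq]
  have hFOC : ∀ α : ℝ, 0 ≤ α → ∀ d, _ := fun α hα0 d =>
    firstOrderCondition hw₁.symm (t := WithLp.toLp 2 fun a =>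
      sampleMoment 0 (trainSize τ n) z (errorVec ε u) ω a 0) (δ := δ) (v := v α) (α := α)
      (fun w => by
        have h := (hβ n ω α hα0).2 (Set.mem_univ (w.ofLp + β₀))
        simp only [Set.mem_ofPred_eq, trainObjective, ridgeObjective] at h
        rw [ivObjective_block_eq_quadLoss hN₁ 0 β₀ _ Γ₀ z ε u ω hS₁,
          ivObjective_block_eq_quadLoss hN₁ 0 β₀ _ Γ₀ z ε u ω hS₁, hpen, hpen,
          add_sub_cancel_right, WithLp.toLp_ofLp] at h
        exact h) d
  have htest : (fun α => testObjective τ n (response β₀ Γ₀ z ε u) (regressor Γ₀ z u) z ω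
      (βhat n ω α)) = fun α => _ := funext fun α =>
    ivObjective_block_eq_quadLoss hN₂ (trainSize τ n) β₀ (βhat n ω α) Γ₀ z ε u ω hS₂
  have hmin := hα n ω
  rw [htest] at hmin
  -- Existence of a minimizer excludes the case in which `αhat` is arbitrary.
  obtain ⟨hmem, hargmin⟩ :=
    hmin (exists_isArgmin_quadLoss hc hcC hδ hw₁ hw₂ ht₁ ht₂ hρ hFOC hA hA₀ hA')
  have hnonneg : 0 ≤ αhat n ω := hA' hmem
  rw [abs_of_nonneg hnonneg, mul_assoc]
  exact le_tuningRate hc hcC hδ hw₁ hw₂ ht₁ ht₂ hρ hFOC hnonneg (hargmin hA₀)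

end Deterministic

/-! ### Second moments of independent sums and Chebyshev's inequality. -/

section Chebyshev

variable {Ω : Type*} [MeasurableSpace Ω]

/-- The cross terms vanish. The form with `∫⁻` lets it serve as the inner integral under the
conditional law of the errors. -/
lemma lintegral_sq_sum_of_indep {ι : Type*} (ν : Measure Ω) [IsProbabilityMeasure ν]
    {X : ι → Ω → ℝ} (s : Finset ι) (hX : ∀ i, MemLp (X i) 2 ν) (hmean : ∀ i, ∫ ω, X i ω ∂ν = 0)
    (hindep : ∀ i j, i ≠ j → IndepFun (X i) (X j) ν) :
    ∫⁻ ω, ENNReal.ofReal ((∑ i ∈ s, X i ω) ^ 2) ∂ν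
      = ENNReal.ofReal (∑ i ∈ s, ∫ ω, X i ω ^ 2 ∂ν) := by
  have hsum : MemLp (∑ i ∈ s, X i) 2 ν := memLp_finsetSum' s fun i _ => hX i
  have hmean' : ∫ ω, (∑ i ∈ s, X i) ω ∂ν = 0 := by
    simp only [Finset.sum_apply]
    rw [integral_finsetSum s fun i _ => (hX i).integrable one_le_two]
    exact Finset.sum_eq_zero fun i _ => hmean i
  have hvar := IndepFun.variance_sum (s := s) (fun i _ => hX i)
    (fun i _ j _ hij => hindep i j hij)
  rw [variance_of_integral_eq_zero hsum.aemeasurable hmean'] at hvar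
  simp only [Finset.sum_apply] at hvar
  rw [← ofReal_integral_eq_lintegral_ofReal (by simpa using hsum.integrable_sq)
    (Eventually.of_forall fun _ => sq_nonneg _)]
  congr 1
  rw [hvar]
  exact Finset.sum_congr rfl fun i _ => variance_of_integral_eq_zero (hX i).aemeasurable (hmean i)

/-- Chebyshev's inequality for an average whose sum has second moment of the order `N`. -/
lemma measure_average_gt_le (P : Measure Ω) {N : ℕ} (hN : N ≠ 0) {Y : Ω → ℝ}
    (hY : Measurable Y) {M K : ℝ} (hK : 0 < K)
    (hM : ∫⁻ ω, ENNReal.ofReal (Y ω ^ 2) ∂P ≤ ENNReal.ofReal (N * M)) :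
    P {ω | ¬ |(N : ℝ)⁻¹ * Y ω| ≤ K / √N} ≤ ENNReal.ofReal (M / K ^ 2) := by
  have hN' : (0 : ℝ) < N := by positivity
  calc P {ω | ¬ |(N : ℝ)⁻¹ * Y ω| ≤ K / √N}
      ≤ P {ω | ENNReal.ofReal (K ^ 2 * N) ≤ ENNReal.ofReal (Y ω ^ 2)} := by
        refine measure_mono fun ω hω => ENNReal.ofReal_le_ofReal ?_
        have hω' : K / √N < (N : ℝ)⁻¹ * |Y ω| := by
          have := not_le.1 hω
          rwa [abs_mul, abs_of_pos (inv_pos.2 hN')] at this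
        rw [← sq_abs (Y ω)]
        rw [inv_mul_eq_div, lt_div_iff₀ hN'] at hω'
        have h1 : K / √N * N = K * √N := by
          rw [div_mul_eq_mul_div, div_eq_iff (by positivity), mul_assoc,
            Real.mul_self_sqrt hN'.le]
        rw [h1] at hω'
        calc K ^ 2 * N = (K * √N) ^ 2 := by rw [mul_pow, Real.sq_sqrt hN'.le]
          _ ≤ |Y ω| ^ 2 := by gcongr
    _ ≤ (∫⁻ ω, ENNReal.ofReal (Y ω ^ 2) ∂P) / ENNReal.ofReal (K ^ 2 * N) :=
        meas_ge_le_lintegral_div (by fun_prop) (by simpa using by positivity) (by simp)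
    _ ≤ ENNReal.ofReal (N * M) / ENNReal.ofReal (K ^ 2 * N) := by gcongr
    _ = ENNReal.ofReal (M / K ^ 2) := by
        rw [← ENNReal.ofReal_div_of_pos (by positivity)]
        congr 1
        field_simp

end Chebyshev

/-! ### Sampling errors of the moments. -/

section Moments

variable {Ω : Type*} [MeasurableSpace Ω] {k m : ℕ} {P : Measure Ω}
  {z : ℕ → Ω → Fin m → ℝ} {ε : ℕ → Ω → ℝ} {u : ℕ → Ω → Fin k → ℝ}

/-- Hölder with `1/4 + 1/4 = 1/2`: finite fourth moments give the products a finite variance. -/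
lemma InstrumentAssumption.memLp_mul (h : InstrumentAssumption P z) (i : ℕ) (a b : Fin m) :
    MemLp (fun ω => z i ω a * z i ω b) 2 P :=
  (h.fourthMoment i b).mul' (h.fourthMoment i a)
    (hpqr := ⟨by
      rw [← ENNReal.toReal_eq_toReal_iff' (by simp) (by simp)]
      rw [ENNReal.toReal_add (by simp) (by simp)]
      simp; norm_num⟩)

lemma InstrumentAssumption.measurable_apply (h : InstrumentAssumption P z) (i : ℕ) (a : Fin m) :
    Measurable fun ω => z i ω a :=
  (measurable_pi_apply a).comp (h.measurable i)

variable [IsProbabilityMeasure P] {V : Matrix (Fin (k + 1)) (Fin (k + 1)) ℝ}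

/-- The sampling error of the second moments of the instruments. -/
lemma InstrumentAssumption.measure_sampleMoment_gt_le (h : InstrumentAssumption P z) (s : ℕ)
    {N : ℕ} (hN : N ≠ 0) (a b : Fin m) {K : ℝ} (hK : 0 < K) :
    P {ω | ¬ |sampleMoment s N z z ω a b - secondMoment P (z 0) a b| ≤ K / √N}
      ≤ ENNReal.ofReal
        ((∫ ω, (z 0 ω a * z 0 ω b - secondMoment P (z 0) a b) ^ 2 ∂P) / K ^ 2) := by
  set R := secondMoment P (z 0) a b with hR
  have hN' : (N : ℝ) ≠ 0 := Nat.cast_ne_zero.2 hN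
  have hφ : Measurable fun x : Fin m → ℝ => x a * x b - R := by fun_prop
  have hid : ∀ i, IdentDistrib (fun ω => z i ω a * z i ω b - R)
      (fun ω => z 0 ω a * z 0 ω b - R) P P := fun i => (h.identDistrib i).comp hφ
  have hLp : ∀ i, MemLp (fun ω => z i ω a * z i ω b - R) 2 P := fun i =>
    (h.memLp_mul i a b).sub (memLp_const R)
  have hmean : ∀ i, ∫ ω, (z i ω a * z i ω b - R) ∂P = 0 := by
    intro i
    rw [(hid i).integral_eq, integral_sub ((h.memLp_mul 0 a b).integrable one_le_two)
      (integrable_const _), integral_const, hR]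
    simp [secondMoment]
  have e : ∀ ω, sampleMoment s N z z ω a b - R
      = (N : ℝ)⁻¹ * ∑ i : Fin N, (z (s + i) ω a * z (s + i) ω b - R) := by
    intro ω
    rw [sampleMoment_apply, Finset.sum_sub_distrib, mul_sub]
    simp [hN']
  simp only [e]
  refine measure_average_gt_le P hN ?_ hK ?_
  · have := h.measurable_apply
    fun_prop
  · rw [lintegral_sq_sum_of_indep P Finset.univ
      (X := fun (i : Fin N) ω => z (s + i) ω a * z (s + i) ω b - R) (fun i => hLp _)
      (fun i => hmean _)
      (fun i j hij => (h.indep.indepFun (by simpa [Fin.ext_iff] using hij)).comp hφ hφ)]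
    refine ENNReal.ofReal_le_ofReal (le_of_eq ?_)
    have hsq : ∀ i, ∫ ω, (z i ω a * z i ω b - R) ^ 2 ∂P
        = ∫ ω, (z 0 ω a * z 0 ω b - R) ^ 2 ∂P := fun i =>
      ((hid i).comp (measurable_id.pow_const 2)).integral_eq
    simp [hsq]

lemma ErrorAssumption.measurable_errorVec (h : ErrorAssumption P z ε u V) (i : ℕ) :
    Measurable (errorVec ε u i) := by
  refine measurable_pi_iff.2 fun j => ?_
  refine Fin.cases ?_ (fun j => ?_) j
  · simpa [errorVec] using h.measurable_ε i
  · exact (measurable_pi_apply j).comp (h.measurable_u i)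

/-- The second moment of the score `Σ_i z_i e_i'`, by conditioning on the instruments. -/
lemma lintegral_sq_sum_score (h₁ : InstrumentAssumption P z) (h₂ : ErrorAssumption P z ε u V)
    (s N : ℕ) (a : Fin m) (j : Fin (k + 1)) :
    ∫⁻ ω, ENNReal.ofReal ((∑ i : Fin N, z (s + i) ω a * errorVec ε u (s + i) ω j) ^ 2) ∂P
      = ENNReal.ofReal (N * ((∫ ω, z 0 ω a ^ 2 ∂P) * V j j)) := by
  have hZ : Measurable fun ω i => z i ω := measurable_pi_iff.2 h₁.measurable
  have hE : Measurable fun ω i => errorVec ε u i ω := measurable_pi_iff.2 h₂.measurable_errorVec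
  have hV : 0 ≤ V j j := h₂.posDef.diag_pos.le
  set f : (ℕ → Fin m → ℝ) × (ℕ → Fin (k + 1) → ℝ) → ENNReal := fun p =>
    ENNReal.ofReal ((∑ i : Fin N, p.1 (s + i) a * p.2 (s + i) j) ^ 2) with hf
  have hfm : Measurable f := by fun_prop
  calc ∫⁻ ω, ENNReal.ofReal ((∑ i : Fin N, z (s + i) ω a * errorVec ε u (s + i) ω j) ^ 2) ∂P
      = ∫⁻ p, f p ∂(P.map fun ω => ((fun i => z i ω), fun i => errorVec ε u i ω)) := by
        rw [lintegral_map hfm (hZ.prodMk hE)]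
    _ = ∫⁻ ζ, ∫⁻ e, f (ζ, e) ∂(condDistrib (fun ω i => errorVec ε u i ω) (fun ω i => z i ω) P ζ)
          ∂(P.map fun ω i => z i ω) := by
        rw [← compProd_map_condDistrib hE.aemeasurable, Measure.lintegral_compProd hfm]
    _ = ∫⁻ ζ, ENNReal.ofReal (∑ i : Fin N, ζ (s + i) a ^ 2 * V j j)
          ∂(P.map fun ω i => z i ω) := by
        -- Given `ζ`, the summands are independent and centered with variance `ζ² V j j`; as `V` is
        -- free of `ζ`, only second moments of the instruments remain.
        refine lintegral_congr_ae ?_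
        filter_upwards [h₂.condIID] with ζ hζ
        simp only [hf]
        rw [lintegral_sq_sum_of_indep _ Finset.univ
          (X := fun (i : Fin N) (e : ℕ → Fin (k + 1) → ℝ) => ζ (s + i) a * e (s + i) j)
          (fun i => (hζ.memLp _ j).const_mul _)
          (fun i => by rw [integral_const_mul, hζ.mean, mul_zero])
          (fun i i' hi => (hζ.indep.indepFun (i := s + i) (j := s + i')
            (by simpa [Fin.ext_iff] using hi)).comp
            (φ := fun x : Fin (k + 1) → ℝ => ζ (s + i) a * x j)
            (ψ := fun x : Fin (k + 1) → ℝ => ζ (s + i') a * x j) (by fun_prop) (by fun_prop))]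
        congr 1
        refine Finset.sum_congr rfl fun i _ => ?_
        simp only [mul_pow]
        rw [integral_const_mul, ← hζ.cov (s + i)]
        simp [secondMoment, sq]
    _ = ∫⁻ ω, ENNReal.ofReal (∑ i : Fin N, z (s + i) ω a ^ 2 * V j j) ∂P := by
        rw [lintegral_map (by fun_prop) hZ]
    _ = ENNReal.ofReal (N * ((∫ ω, z 0 ω a ^ 2 ∂P) * V j j)) := by
        have hint : ∀ i, Integrable (fun ω => z i ω a ^ 2 * V j j) P := fun i =>
          (((h₁.memLp_mul i a a).integrable one_le_two).congr
            (Eventually.of_forall fun ω => (sq _).symm)).mul_const _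
        rw [← ofReal_integral_eq_lintegral_ofReal (integrable_finsetSum _ fun i _ => hint _)
          (Eventually.of_forall fun ω => Finset.sum_nonneg fun i _ =>
            mul_nonneg (sq_nonneg _) hV), integral_finsetSum _ fun i _ => hint _]
        congr 1
        have hid : ∀ i, ∫ ω, z i ω a ^ 2 ∂P = ∫ ω, z 0 ω a ^ 2 ∂P := fun i =>
          ((h₁.identDistrib i).comp (u := fun x : Fin m → ℝ => x a ^ 2) (by fun_prop)).integral_eq
        simp [integral_mul_const, hid]

/-- The sampling error of the scores. -/
lemma measure_score_gt_le (h₁ : InstrumentAssumption P z) (h₂ : ErrorAssumption P z ε u V)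
    (s : ℕ) {N : ℕ} (hN : N ≠ 0) (a : Fin m) (j : Fin (k + 1)) {K : ℝ} (hK : 0 < K) :
    P {ω | ¬ |sampleMoment s N z (errorVec ε u) ω a j| ≤ K / √N}
      ≤ ENNReal.ofReal (((∫ ω, z 0 ω a ^ 2 ∂P) * V j j) / K ^ 2) := by
  simp only [sampleMoment_apply]
  refine measure_average_gt_le P hN ?_ hK (lintegral_sq_sum_score h₁ h₂ s N a j).le
  have h3 := h₁.measurable_apply
  have h4 : ∀ i, Measurable fun ω => errorVec ε u i ω j := fun i =>
    (measurable_pi_apply j).comp (h₂.measurable_errorVec i)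
  fun_prop

/-- The sample moments are within `O_p(N^{-1/2})` of their limits, uniformly over blocks. -/
lemma exists_measure_not_momentsNear_le (h₁ : InstrumentAssumption P z)
    (h₂ : ErrorAssumption P z ε u V) {η : ENNReal} (hη : 0 < η) :
    ∃ K > 0, ∀ s N, N ≠ 0 →
      P {ω | ¬ MomentsNear (secondMoment P (z 0)) z ε u s N (K / √N) ω} ≤ η := by
  -- `D K` is the union bound over all entries. It involves neither `s` nor `N`, so one `K` serves
  -- every block.
  set D : ℝ → ENNReal := fun K =>
    (∑ a, ∑ b, ENNReal.ofReal
      ((∫ ω, (z 0 ω a * z 0 ω b - secondMoment P (z 0) a b) ^ 2 ∂P) / K ^ 2))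
      + ∑ a, ∑ j, ENNReal.ofReal (((∫ ω, z 0 ω a ^ 2 ∂P) * V j j) / K ^ 2) with hD
  have hlim : Tendsto D atTop (𝓝 0) := by
    have h0 : ∀ x : ℝ, Tendsto (fun K : ℝ => ENNReal.ofReal (x / K ^ 2)) atTop (𝓝 0) := by
      intro x
      have := ENNReal.tendsto_ofReal
        ((tendsto_const_nhds (x := x)).div_atTop (tendsto_pow_atTop (α := ℝ) two_ne_zero))
      simpa using this
    have : Tendsto D atTop (𝓝 ((∑ _a : Fin m, ∑ _b : Fin m, (0 : ENNReal))
        + ∑ _a : Fin m, ∑ _j : Fin (k + 1), (0 : ENNReal))) :=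
      (tendsto_finsetSum _ fun a _ => tendsto_finsetSum _ fun b _ => h0 _).add
        (tendsto_finsetSum _ fun a _ => tendsto_finsetSum _ fun j _ => h0 _)
    simpa using this
  obtain ⟨K, hKη, hK⟩ := ((hlim.eventually_le_const hη).and (eventually_gt_atTop 0)).exists
  refine ⟨K, hK, fun s N hN => le_trans ?_ hKη⟩
  have hsub : {ω | ¬ MomentsNear (secondMoment P (z 0)) z ε u s N (K / √N) ω} ⊆
      (⋃ a, ⋃ b, {ω | ¬ |sampleMoment s N z z ω a b - secondMoment P (z 0) a b| ≤ K / √N})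
        ∪ ⋃ a, ⋃ j, {ω | ¬ |sampleMoment s N z (errorVec ε u) ω a j| ≤ K / √N} := by
    intro ω hω
    simp only [MomentsNear, Set.mem_ofPred_eq, not_and_or, not_forall] at hω
    simpa only [Set.mem_union, Set.mem_iUnion, Set.mem_ofPred_eq] using hω
  refine (measure_mono hsub).trans ((measure_union_le _ _).trans (add_le_add ?_ ?_))
  · exact (measure_iUnion_fintype_le _ _).trans (Finset.sum_le_sum fun a _ =>
      (measure_iUnion_fintype_le _ _).trans (Finset.sum_le_sum fun b _ =>
        h₁.measure_sampleMoment_gt_le s hN a b hK))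
  · exact (measure_iUnion_fintype_le _ _).trans (Finset.sum_le_sum fun a _ =>
      (measure_iUnion_fintype_le _ _).trans (Finset.sum_le_sum fun j _ =>
        measure_score_gt_le h₁ h₂ s hN a j hK))

end Moments

/-! ### Sample sizes and passage to the limit. -/

section Asymptotics

/-- Both subsamples have size of the order `n`. -/
lemma exists_mul_le_sampleSizes {τ : ℝ} (hτ₀ : 0 < τ) (hτ₁ : τ < 1) :
    ∃ κ > 0, ∀ᶠ n : ℕ in atTop,
      κ * n ≤ (trainSize τ n : ℝ) ∧ κ * n ≤ ((n - trainSize τ n : ℕ) : ℝ) := by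
  -- The floor loses less than `1`, which is at most `τ n / 2` for large `n`; hence `τ / 2`.
  refine ⟨min (τ / 2) (1 - τ), lt_min (by positivity) (by linarith), ?_⟩
  have h := (tendsto_natCast_atTop_atTop (R := ℝ)).const_mul_atTop (by positivity : 0 < τ / 2)
  filter_upwards [h.eventually_ge_atTop 1] with n hn
  have hn0 : (0 : ℝ) ≤ n := Nat.cast_nonneg n
  have h1 := Nat.lt_floor_add_one (τ * n)
  have h2 : (⌊τ * n⌋₊ : ℝ) ≤ τ * n := Nat.floor_le (by positivity)
  have h3 : ⌊τ * n⌋₊ ≤ n := by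
    have : (⌊τ * n⌋₊ : ℝ) ≤ n := by nlinarith
    exact_mod_cast this
  unfold trainSize
  rw [Nat.cast_sub h3]
  constructor
  · nlinarith [mul_le_mul_of_nonneg_right (min_le_left (τ / 2) (1 - τ)) hn0]
  · nlinarith [mul_le_mul_of_nonneg_right (min_le_right (τ / 2) (1 - τ)) hn0]

lemma MomentsNear.mono {Ω : Type*} [MeasurableSpace Ω] {k m : ℕ} {R : Matrix (Fin m) (Fin m) ℝ}
    {z : ℕ → Ω → Fin m → ℝ} {ε : ℕ → Ω → ℝ} {u : ℕ → Ω → Fin k → ℝ} {s N : ℕ} {r r' : ℝ}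
    {ω : Ω} (h : MomentsNear R z ε u s N r ω) (hr : r ≤ r') : MomentsNear R z ε u s N r' ω :=
  ⟨fun a b => (h.1 a b).trans hr, fun a j => (h.2 a j).trans hr⟩

lemma tendstoInMeasure_zero_of_boundedInProbability {Ω : Type*} [MeasurableSpace Ω]
    {P : Measure Ω} {W : ℕ → Ω → ℝ}
    (h : BoundedInProbability P fun n ω => √n * W n ω) :
    TendstoInMeasure P W atTop fun _ => 0 := by
  rw [tendstoInMeasure_iff_norm]
  intro e he
  rw [ENNReal.tendsto_nhds_zero]
  intro η hη
  obtain ⟨C, hC⟩ := h η hη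
  have hlim := (Real.tendsto_sqrt_atTop.comp
    (tendsto_natCast_atTop_atTop (R := ℝ))).atTop_mul_const he
  filter_upwards [hC, hlim.eventually_gt_atTop C] with n hn hn'
  refine (measure_mono fun ω hω => ?_).trans hn
  have hω' : e ≤ |W n ω| := by simpa using hω
  simp only [Set.mem_ofPred_eq, abs_mul, abs_of_nonneg (Real.sqrt_nonneg (n : ℝ))]
  exact hn'.trans_le (mul_le_mul_of_nonneg_left hω' (Real.sqrt_nonneg _))

end Asymptotics

end RidgePath

theorem lemma1 {Ω : Type*} [MeasurableSpace Ω] (P : Measure Ω) [IsProbabilityMeasure P]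
    {k m : ℕ}
    (z : ℕ → Ω → Fin m → ℝ) (ε : ℕ → Ω → ℝ) (u : ℕ → Ω → Fin k → ℝ)
    (β₀ βp : Fin k → ℝ) (Γ₀ : Matrix (Fin m) (Fin k) ℝ)
    (V : Matrix (Fin (k + 1)) (Fin (k + 1)) ℝ)
    (B₁ B₂ B₃ B₄ : ℝ) (hB₁ : 0 < B₁) (hB₂ : 0 < B₂) (hB₃ : 0 < B₃) (hB₄ : 0 < B₄)
    (τ : ℝ) (hτ₀ : 0 < τ) (hτ₁ : τ < 1)
    (hprior : βp ≠ β₀)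
    (h₁ : RidgePath.InstrumentAssumption P z)
    (h₂ : RidgePath.ErrorAssumption P z ε u V)
    (h₃ : RidgePath.ParameterAssumption (RidgePath.secondMoment P (z 0)) β₀ Γ₀ B₁ B₂ B₃)
    (A : Set ℝ) (hA : A = Set.Ici 0 ∨ A = Set.Icc 0 B₄)
    (βhat : ℕ → Ω → ℝ → Fin k → ℝ)
    (hβ : RidgePath.IsRidgePath τ (RidgePath.response β₀ Γ₀ z ε u)
      (RidgePath.regressor Γ₀ z u) z βp βhat)
    (αhat : ℕ → Ω → ℝ)
    (hα : RidgePath.IsTuningParameter τ (RidgePath.response β₀ Γ₀ z ε u)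
      (RidgePath.regressor Γ₀ z u) z βhat A αhat) :
    TendstoInMeasure P αhat atTop (fun _ => 0) ∧
      RidgePath.BoundedInProbability P (fun n ω => Real.sqrt n * αhat n ω) := by
  suffices h : RidgePath.BoundedInProbability P (fun n ω => Real.sqrt n * αhat n ω) from
    ⟨RidgePath.tendstoInMeasure_zero_of_boundedInProbability h, h⟩
  have hAclosed : IsClosed A := by
    rcases hA with rfl | rfl
    · exact isClosed_Ici
    · exact isClosed_Icc
  have hA₀ : 0 ∈ A := by
    rcases hA with rfl | rfl
    · exact Set.self_mem_Ici
    · exact ⟨le_rfl, hB₄.le⟩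
  have hA' : A ⊆ Set.Ici 0 := by
    rcases hA with rfl | rfl
    · exact subset_rfl
    · exact Set.Icc_subset_Ici_self
  obtain ⟨L, hL, r₀, hr₀, hdet⟩ := RidgePath.exists_tuningParameter_le h₃.posDef h₃.fullRank
    hprior z ε u τ hAclosed hA₀ hA' hβ hα
  obtain ⟨κ, hκ, hsize⟩ := RidgePath.exists_mul_le_sampleSizes hτ₀ hτ₁
  intro η hη
  obtain ⟨K, hK, hprob⟩ :=
    RidgePath.exists_measure_not_momentsNear_le h₁ h₂ (ENNReal.half_pos hη.ne')
  have hlim : Tendsto (fun n : ℕ => K / √(κ * n)) atTop (𝓝 0) :=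
    tendsto_const_nhds.div_atTop (Real.tendsto_sqrt_atTop.comp
      ((tendsto_natCast_atTop_atTop (R := ℝ)).const_mul_atTop hκ))
  -- Both blocks have at least `κ n` observations, so `K / √(κ n)` is a common radius; multiplied by
  -- `L √n` it gives this constant.
  refine ⟨L * (K / √κ), ?_⟩
  filter_upwards [hsize, hlim.eventually_le_const hr₀, eventually_gt_atTop 0]
    with n hn hnr hn0
  have hn0' : (0 : ℝ) < n := Nat.cast_pos.2 hn0
  have hpos : 0 < κ * n := by positivity
  have hN₁ : RidgePath.trainSize τ n ≠ 0 := by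
    have := hpos.trans_le hn.1
    exact (Nat.cast_pos.1 this).ne'
  have hN₂ : n - RidgePath.trainSize τ n ≠ 0 := by
    have := hpos.trans_le hn.2
    exact (Nat.cast_pos.1 this).ne'
  have hle : ∀ N : ℕ, κ * n ≤ (N : ℝ) → K / √N ≤ K / √(κ * n) := fun N hN => by
    gcongr
  refine le_trans (measure_mono ?_) ((measure_union_le _ _).trans ((add_le_add
    (hprob 0 _ hN₁) (hprob (RidgePath.trainSize τ n) _ hN₂)).trans (ENNReal.add_halves η).le))
  intro ω hω
  by_contra hgood
  simp only [Set.mem_union, Set.mem_ofPred_eq, not_or, not_not] at hgood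
  have hbound := hdet n ω (K / √(κ * n)) hN₁ hN₂ (by positivity) hnr
    (hgood.1.mono (hle _ hn.1)) (hgood.2.mono (hle _ hn.2))
  rw [Set.mem_ofPred_eq] at hω
  refine absurd hω (not_lt.2 ?_)
  rw [abs_mul, abs_of_nonneg (Real.sqrt_nonneg (n : ℝ))]
  calc √(n : ℝ) * |αhat n ω| ≤ √(n : ℝ) * (L * (K / √(κ * n))) := by gcongr
    _ = L * (K / √κ) := by
        rw [Real.sqrt_mul hκ.le]
        have : √(n : ℝ) ≠ 0 := by positivity
        have : √κ ≠ 0 := by positivity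
        field_simp
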